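/- \textbf{Setting.} For $n \ge 1$ let $I_n = I(3n, n^4+1, U, 1)$ be the instance of the capacitated facility location problem (CFL) with a set $F$ of $3n$ facilities, each of capacity $U$, where $(n^4+1) - nU = 2^{-n^2}$, and a set $C$ of $n^4+1$ clients, each of unit demand. In the classic variables $y_i$, $x_{ij}$ ($i \in F$, $j \in C$) the feasible mixed integer solutions are the $(y,x)$ with $y_i \in \{0,1\}$, $0 \le x_{ij} \le y_i$, $\sum_i x_{ij} = 1$ for every $j$, and $\sum_j x_{ij} \le U y_i$ for every $i$; the CFL polytope of $I_n$ is their convex hull. The admissible objective functions are $\sum_i f_i y_i + \sum_{i,j} c_{ij} x_{ij}$ (to be minimized) with $f_i \ge 0$, $c_{ij} \ge 0$ and $c_{ij} \le c_{ij'} + c_{i'j'} + c_{i'j}$ for all $i,i' \in F$, $j,j' \in C$. The integrality gap of a relaxation $K$ of the CFL polytope is the supremum, over all admissible objective functions, of the ratio of the minimum cost of a feasible mixed integer solution to the minimum cost over $K$ (the ratio is $\infty$ if the former is positive and the latter is not). The size of a polyhedron is the minimum number of inequalities in a halfspace description of it. For a polyhedron $P$ described by finitely many inequalities $\pi(y,x)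 \le 0$ with $\pi$ affine, the level-$t$ Sherali--Adams relaxation $\operatorname{SA}^t(P)$ is obtained by multiplying every inequality of the description by $\prod_{i \in A \setminus W} y_i \prod_{i \in W} (1-y_i)$ for all $W \subseteq A \subseteq F$ with $|A| \le t$, linearizing (replace $y_i^2$ by $y_i$, then every product $\prod_{i \in S} y_i$ and every product $x_{kj} \prod_{i \in S} y_i$ by a single new variable), and projecting onto the original variables $(y,x)$. \textbf{Theorem.} There are constants $c > 0$ and $\gamma > 0$ such that the following holds. For every $n$ let $P_n$ be a linear relaxation, in the classic variables, of the CFL polytope of $I_n$ (a polyhedron, given by a finite system of linear inequalities, that contains the CFL polytope), and suppose that the size of $P_n$ is $2^{o(n)}$. Then, for all sufficiently large $n$ and all integers $0 \le t \le cn$, the integrality gap of $\operatorname{SA}^t(P_n)$ is at least $\gamma n$; in short, it is $\Omega(n)$. In particular $c$ and $\gamma$ are independent of the starting relaxations $P_n$. -/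

import Mathlib

open Filter Asymptotics
open scoped ENNReal Matrix

/-! ### Systems of linear inequalities and polyhedra -/

/-- A system `A v ≤ b` of `r` linear inequalities in the real variables indexed by `V`. -/
structure LinSystem (V : Type*) (r : ℕ) where
  A : Matrix (Fin r) V ℝ
  b : Fin r → ℝ

/-- The polyhedron `{v | A v ≤ b}`. -/
def LinSystem.polyhedron {V : Type*} [Fintype V] {r : ℕ} (S : LinSystem V r) : Set (V → ℝ) :=
  {v | ∀ a : Fin r, ∑ k, S.A a k * v k ≤ S.b a}

/-- The size of a polyhedron: the minimum number of inequalities in a halfspace description. -/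
noncomputable def polyhedronSize {V : Type*} [Fintype V] (K : Set (V → ℝ)) : ℕ :=
  sInf {r : ℕ | ∃ S : LinSystem V r, S.polyhedron = K}

/-- `s n = 2 ^ o(n)`. -/
def IsTwoPowLittleO (s : ℕ → ℕ) : Prop :=
  ∃ g : ℕ → ℝ, g =o[atTop] (fun n : ℕ => (n : ℝ)) ∧ ∀ᶠ n in atTop, (s n : ℝ) ≤ (2 : ℝ) ^ g n

/-! ### The Sherali–Adams procedure for mixed integer sets

The variables are indexed by `ι ⊕ κ`: the integer variables by `ι`, the fractional ones by `κ`. -/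

/-- A vector in the linearized space: `int I` is the variable standing for `∏ i ∈ I, x_i`, and
`mix I k` is the variable standing for `x_k * ∏ i ∈ I, x_i`, where `x_k` is fractional. -/
structure LiftedVector (ι κ : Type*) where
  int : Finset ι → ℝ
  mix : Finset ι → κ → ℝ

/-- The linearization of `(∑ i, α (inl i) * x_i + ∑ k, α (inr k) * x_k - β) * ∏ i ∈ I, x_i`,
where `x_i ^ 2` is replaced by `x_i` for the integer variables. -/
def linearizedTerm {ι κ : Type*} [Fintype ι] [Fintype κ] [DecidableEq ι]
    (α : ι ⊕ κ → ℝ) (β : ℝ) (z : LiftedVector ι κ) (I : Finset ι) : ℝ :=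
  ∑ i, α (Sum.inl i) * z.int (insert i I) + ∑ k, α (Sum.inr k) * z.mix I k - β * z.int I

/-- The linearization of `(α x - β) * ∏ i ∈ U \ W, x_i * ∏ i ∈ W, (1 - x_i)` for `W ⊆ U`; the
last product is expanded as `∑ T ⊆ W, (-1) ^ |T| * ∏ i ∈ T, x_i`. -/
def linearizedLift {ι κ : Type*} [Fintype ι] [Fintype κ] [DecidableEq ι]
    (α : ι ⊕ κ → ℝ) (β : ℝ) (z : LiftedVector ι κ) (U W : Finset ι) : ℝ :=
  ∑ T ∈ W.powerset, (-1 : ℝ) ^ T.card * linearizedTerm α β z ((U \ W) ∪ T)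

/-- The level-`t` Sherali–Adams system in the linearized space, before projection. -/
def saLifted {ι κ : Type*} [Fintype ι] [Fintype κ] [DecidableEq ι] {r : ℕ}
    (S : LinSystem (ι ⊕ κ) r) (t : ℕ) : Set (LiftedVector ι κ) :=
  {z | z.int ∅ = 1 ∧
    ∀ (a : Fin r) (U W : Finset ι), U.card ≤ t → W ⊆ U →
      linearizedLift (S.A a) (S.b a) z U W ≤ 0}

/-- The projection of a linearized vector to the original variables. -/
def LiftedVector.proj {ι κ : Type*} (z : LiftedVector ι κ) : ι ⊕ κ → ℝ :=
  Sum.elim (fun i => z.int {i}) (fun k => z.mix ∅ k)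

/-- The level-`t` Sherali–Adams relaxation obtained from the system `S`. -/
def sheraliAdams {ι κ : Type*} [Fintype ι] [Fintype κ] [DecidableEq ι] {r : ℕ}
    (S : LinSystem (ι ⊕ κ) r) (t : ℕ) : Set (ι ⊕ κ → ℝ) :=
  LiftedVector.proj '' saLifted S t

/-! ### Capacitated facility location -/

/-- The capacities and the demands of an instance with `N` facilities and `m` clients. -/
structure CFLInstance (N m : ℕ) where
  capacity : Fin N → ℝ
  demand : Fin m → ℝ

/-- The classic variables: `inl i` is the opening variable `y_i` of facility `i`, and `inr (i, j)`
is `x_{ij}`, the fraction of the demand of client `j` assigned to facility `i`. -/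
abbrev CFLVar (N m : ℕ) : Type := Fin N ⊕ (Fin N × Fin m)

/-- The feasible mixed integer solutions: facilities are opened integrally, the demand of every
client is fully (possibly fractionally) assigned to open facilities, capacities are respected. -/
def CFLInstance.feasible {N m : ℕ} (I : CFLInstance N m) : Set (CFLVar N m → ℝ) :=
  {v | (∀ i, v (Sum.inl i) = 0 ∨ v (Sum.inl i) = 1) ∧
    (∀ i j, 0 ≤ v (Sum.inr (i, j)) ∧ v (Sum.inr (i, j)) ≤ v (Sum.inl i)) ∧
    (∀ j, ∑ i, v (Sum.inr (i, j)) = 1) ∧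
    (∀ i, ∑ j, I.demand j * v (Sum.inr (i, j)) ≤ I.capacity i * v (Sum.inl i))}

/-- The CFL polytope: the convex hull of the feasible mixed integer solutions. -/
def CFLInstance.polytope {N m : ℕ} (I : CFLInstance N m) : Set (CFLVar N m → ℝ) :=
  convexHull ℝ I.feasible

/-- An admissible objective function: nonnegative opening costs, and nonnegative connection costs
satisfying the triangle inequality for facilities and clients. -/
structure CFLCost (N m : ℕ) where
  opening : Fin N → ℝ
  conn : Fin N → Fin m → ℝ
  opening_nonneg : ∀ i, 0 ≤ opening i
  conn_nonneg : ∀ i j, 0 ≤ conn i j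
  conn_triangle : ∀ i i' j j', conn i j ≤ conn i j' + conn i' j' + conn i' j

/-- The total opening and connection cost; connection costs are per unit of demand. -/
def CFLInstance.cost {N m : ℕ} (I : CFLInstance N m) (w : CFLCost N m)
    (v : CFLVar N m → ℝ) : ℝ :=
  ∑ i, w.opening i * v (Sum.inl i) + ∑ i, ∑ j, w.conn i j * (I.demand j * v (Sum.inr (i, j)))

/-- The integrality gap of a relaxation `K`: the supremum, over all admissible objective functions,
of the ratio of the minimum cost of a feasible mixed integer solution to the minimum cost over `K`.
Negative costs, which only points of `K` with negative coordinates can have, count as `0`; a ratio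
`0 / 0` counts as `0`, and `a / 0` with `a > 0` as `∞`. -/
noncomputable def CFLInstance.integralityGap {N m : ℕ} (I : CFLInstance N m)
    (K : Set (CFLVar N m → ℝ)) : ℝ≥0∞ :=
  ⨆ w : CFLCost N m,
    (⨅ v ∈ I.feasible, ENNReal.ofReal (I.cost w v)) / (⨅ v ∈ K, ENNReal.ofReal (I.cost w v))

/-- The instance `I(3n, n^4+1, U, 1)`: `3n` facilities of uniform capacity `U`, where
`(n^4 + 1) - n U = 2^{-n^2}`, and `n^4 + 1` clients of unit demand. -/
noncomputable def gapInstance (n : ℕ) : CFLInstance (3 * n) (n ^ 4 + 1) where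
  capacity := fun _ => (((n : ℝ) ^ 4 + 1) - 1 / (2 : ℝ) ^ (n ^ 2)) / n
  demand := fun _ => 1

/-!
Fix a set `D` of `2n` facilities. Each `n`-element subset `A` of `D` gives an objective function:
opening a facility outside of `D` costs `1`, using one of `D \ A` costs `2 ^ n ^ 2` per unit, and all
else is free. Since `A` lacks a capacity of `2 ^ (-n ^ 2)`, every mixed integer solution costs at
least `1`. A fractional solution of cost `1 / n` opens `D`, opens each of the `n` facilities outside
of `D` to the extent `1 / n ^ 2`, and does not use `D \ A`.

This fractional solution is the mean of a distribution in which at most one facility outside of `D`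
is open; the point of the event that none is open exceeds the capacity of `A`, the other points are
feasible. The expectations of monomials solve the Sherali–Adams system if all means conditioned on
prescribed values of at most `n / 2` of the opening variables satisfy the original system
(`sum_smul_mem_sheraliAdams`). Only the means conditioned on a set `W` outside of `D` being closed
(`condPoint`) are in question. They need not lie in the polytope, but do so after
`2 ^ (-n ^ 2)` units of load are moved from any `i' ∈ A` to any `i ∈ D \ A`
(`condPoint_add_mem_polytope`). If conditional means of two sets `A ≠ A'` violated the same valid
inequality, then moving load from `i' ∈ A \ A'` to `i ∈ A' \ A` in one of them and back in the
other would preserve their sum and yield two points of the polytope, a contradiction. So each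
inequality of a minimal description is violated for at most one `A`
(`exists_condPoint_subset_polyhedron`). There are `Nat.centralBinom n ≥ 2 ^ n` choices of `A`, more
than the size `2 ^ o(n)` of the relaxation, so that some `A` violates nothing.
-/

/-! ### Sherali–Adams vectors from distributions -/

lemma sum_neg_one_pow_card_union_subset {ι : Type*} [DecidableEq ι]
    (U W O : Finset ι) :
    ∑ T ∈ W.powerset, (-1 : ℝ) ^ T.card * (if (U \ W) ∪ T ⊆ O then 1 else 0) =
      if U \ W ⊆ O ∧ Disjoint W O then 1 else 0 := by
  by_cases h : U \ W ⊆ O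
  · have h1 : ∑ T ∈ W.powerset, (-1 : ℝ) ^ T.card * (if (U \ W) ∪ T ⊆ O then 1 else 0) =
        ∑ T ∈ (W ∩ O).powerset, (-1 : ℝ) ^ T.card := by
      simp only [Finset.union_subset_iff, h, true_and, mul_ite, mul_one, mul_zero]
      rw [← Finset.sum_filter]
      refine Finset.sum_congr ?_ fun _ _ => rfl
      ext T
      simp only [Finset.mem_filter, Finset.mem_powerset, Finset.subset_inter_iff]
    have h2 := Finset.sum_powerset_neg_one_pow_card (x := W ∩ O)
    have h3 : ∑ T ∈ (W ∩ O).powerset, (-1 : ℝ) ^ T.card = if W ∩ O = ∅ then 1 else 0 := by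
      exact_mod_cast h2
    rw [h1, h3]
    simp [h, Finset.disjoint_iff_inter_eq_empty]
  · simp [Finset.union_subset_iff, h]

section Distribution

variable {ι κ E : Type*} [Fintype ι] [Fintype κ] [DecidableEq ι] [Fintype E]

/-- The point with integer part the indicator of `O` and fractional part `x`. -/
def integralPoint (O : Finset ι) (x : κ → ℝ) : ι ⊕ κ → ℝ :=
  Sum.elim (fun i => if i ∈ O then 1 else 0) x

/-- The lifted vector of a distribution on the points `integralPoint (O e) (x e)`: the entries are
the expectations of the monomials. The fractional parts are arbitrary, so the single points need
not satisfy any constraint. -/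
def expectationLift (p : E → ℝ) (O : E → Finset ι) (x : E → κ → ℝ) : LiftedVector ι κ where
  int I := ∑ e, if I ⊆ O e then p e else 0
  mix I k := ∑ e, if I ⊆ O e then p e * x e k else 0

lemma linearizedTerm_expectationLift (p : E → ℝ) (O : E → Finset ι) (x : E → κ → ℝ)
    (α : ι ⊕ κ → ℝ) (β : ℝ) (I : Finset ι) :
    linearizedTerm α β (expectationLift p O x) I =
      ∑ e, if I ⊆ O e then p e * (∑ k, α k * integralPoint (O e) (x e) k - β) else 0 := by
  unfold linearizedTerm expectationLift
  simp only [Finset.mul_sum]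
  rw [Finset.sum_comm, Finset.sum_comm (s := (Finset.univ : Finset κ)), ← Finset.sum_add_distrib,
    ← Finset.sum_sub_distrib]
  refine Finset.sum_congr rfl fun e _ => ?_
  by_cases h : I ⊆ O e
  · simp only [Finset.insert_subset_iff, h, and_true, if_true, Fintype.sum_sum_type,
      integralPoint, Sum.elim_inl, Sum.elim_inr, mul_sub, mul_add, Finset.mul_sum]
    congr 1
    · congr 1
      · refine Finset.sum_congr rfl fun i _ => ?_
        split_ifs <;> ring
      · exact Finset.sum_congr rfl fun k _ => by ring
    · ring
  · simp [Finset.insert_subset_iff, h]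

/-- Lifting an inequality by `∏ i ∈ U \ W, y_i * ∏ i ∈ W, (1 - y_i)` restricts the expectation to
the event that `y` is `1` on `U \ W` and `0` on `W`. -/
lemma linearizedLift_expectationLift (p : E → ℝ) (O : E → Finset ι) (x : E → κ → ℝ)
    (α : ι ⊕ κ → ℝ) (β : ℝ) (U W : Finset ι) :
    linearizedLift α β (expectationLift p O x) U W =
      ∑ e, if U \ W ⊆ O e ∧ Disjoint W (O e) then
        p e * (∑ k, α k * integralPoint (O e) (x e) k - β) else 0 := by
  unfold linearizedLift
  simp only [linearizedTerm_expectationLift, Finset.mul_sum]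
  rw [Finset.sum_comm]
  refine Finset.sum_congr rfl fun e _ => ?_
  have h := congrArg (· * (p e * (∑ k, α k * integralPoint (O e) (x e) k - β)))
    (sum_neg_one_pow_card_union_subset U W (O e))
  simp only [Finset.sum_mul, ite_mul, one_mul, zero_mul] at h
  rw [← h]
  refine Finset.sum_congr rfl fun T _ => ?_
  split_ifs <;> simp

/-- If the points of a distribution satisfy a system on average, conditioned on any values of
at most `t` of the integer variables, then their mean is in the level-`t` relaxation. -/
lemma sum_smul_mem_sheraliAdams {r t : ℕ} {S : LinSystem (ι ⊕ κ) r} {p : E → ℝ}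
    {O : E → Finset ι} {x : E → κ → ℝ} (hp : ∑ e, p e = 1)
    (h : ∀ (a : Fin r) (U W : Finset ι), U.card ≤ t → W ⊆ U →
      (∑ e, if U \ W ⊆ O e ∧ Disjoint W (O e) then
        p e * (∑ k, S.A a k * integralPoint (O e) (x e) k - S.b a) else 0) ≤ 0) :
    ∑ e, p e • integralPoint (O e) (x e) ∈ sheraliAdams S t := by
  refine ⟨expectationLift p O x, ⟨by simp [expectationLift, hp], fun a U W hU hW => ?_⟩, ?_⟩
  · rw [linearizedLift_expectationLift]
    exact h a U W hU hW
  · ext k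
    rcases k with i | k
    · simp [expectationLift, LiftedVector.proj, integralPoint, Finset.sum_apply]
    · simp [expectationLift, LiftedVector.proj, integralPoint, Finset.sum_apply]

end Distribution

/-! ### Polyhedra of small size -/

lemma exists_linSystem_polyhedronSize {V : Type*} [Fintype V] {r : ℕ} (S : LinSystem V r) :
    ∃ S' : LinSystem V (polyhedronSize S.polyhedron), S'.polyhedron = S.polyhedron :=
  Nat.sInf_mem (s := {r : ℕ | ∃ S' : LinSystem V r, S'.polyhedron = S.polyhedron}) ⟨r, S, rfl⟩

/-- If, for any points `v` and `v'` of different members of a family of sets, `v + v'` is a sum of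
two points of the polyhedron, and the family has more members than the size of the polyhedron, then
some member lies in the polyhedron: otherwise points of two different members violate the same
inequality, and then so does every pair with the same sum, in one of its points. -/
lemma exists_subset_polyhedron {V τ : Type*} [Fintype V] {r : ℕ} (S : LinSystem V r)
    (F : Finset τ) (X : τ → Set (V → ℝ)) (hcard : polyhedronSize S.polyhedron < F.card)
    (hX : ∀ s ∈ F, ∀ s' ∈ F, s ≠ s' → ∀ v ∈ X s, ∀ v' ∈ X s',
      ∃ u ∈ S.polyhedron, ∃ u' ∈ S.polyhedron, v + v' = u + u') :
    ∃ s ∈ F, X s ⊆ S.polyhedron := by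
  obtain ⟨S', hS'⟩ := exists_linSystem_polyhedronSize S
  by_contra! hcon
  have hviol : ∀ s : F, ∃ a, ∃ v ∈ X s, S'.b a < ∑ k, S'.A a k * v k := by
    intro s
    obtain ⟨v, hv, hvS⟩ := Set.not_subset.1 (hcon s s.2)
    rw [← hS'] at hvS
    simp only [LinSystem.polyhedron, Set.mem_ofPred_eq, not_forall, not_le] at hvS
    obtain ⟨a, ha⟩ := hvS
    exact ⟨a, v, hv, ha⟩
  choose f v hv hlt using hviol
  obtain ⟨s, s', hne, hf⟩ := Fintype.exists_ne_map_eq_of_card_lt f (by simpa using hcard)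
  obtain ⟨u, hu, u', hu', huu⟩ :=
    hX s s.2 s' s'.2 (fun h => hne (Subtype.ext h)) _ (hv s) _ (hv s')
  rw [← hS'] at hu hu'
  have h1 := hlt s
  have h2 := hlt s'
  rw [← hf] at h2
  have h3 := hu (f s)
  have h4 := hu' (f s)
  have h5 : ∑ k, S'.A (f s) k * v s k + ∑ k, S'.A (f s) k * v s' k =
      ∑ k, S'.A (f s) k * u k + ∑ k, S'.A (f s) k * u' k := by
    simp only [← Finset.sum_add_distrib, ← mul_add]
    exact Finset.sum_congr rfl fun k _ => by
      rw [show v s k + v s' k = u k + u' k from congrFun huu k]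
  linarith

lemma IsTwoPowLittleO.eventually_lt_centralBinom {s : ℕ → ℕ} (hs : IsTwoPowLittleO s) :
    ∀ᶠ n in atTop, s n < n.centralBinom := by
  obtain ⟨g, hg, hsg⟩ := hs
  filter_upwards [hg.bound one_pos, hsg, eventually_ge_atTop 4] with n h1 h2 h3
  have h4 : g n ≤ n := by
    have := le_abs_self (g n)
    simp only [Real.norm_eq_abs, one_mul, Nat.abs_cast] at h1
    linarith
  have h5 : (s n : ℝ) ≤ ((2 ^ n : ℕ) : ℝ) := by
    refine h2.trans ((Real.rpow_le_rpow_of_exponent_le one_le_two h4).trans ?_)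
    simp
  have h6 := Nat.four_pow_lt_mul_centralBinom n h3
  have h7 : n * n.centralBinom ≤ 2 ^ n * n.centralBinom :=
    Nat.mul_le_mul_right _ Nat.lt_two_pow_self.le
  have h8 : 2 ^ n * 2 ^ n < 2 ^ n * n.centralBinom := by
    rw [← mul_pow]
    exact h6.trans_le h7
  exact (Nat.cast_le.1 h5).trans_lt (lt_of_mul_lt_mul_left h8 (Nat.zero_le _))

/-! ### Points that treat all clients alike -/

/-- The facilities in `O` are open, and facility `i` serves the amount `load i`, spread evenly over
the clients. -/
noncomputable def loadPoint {N : ℕ} (m : ℕ) (O : Finset (Fin N)) (load : Fin N → ℝ) :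
    CFLVar N m → ℝ :=
  integralPoint O fun k => load k.1 / m

lemma loadPoint_mem_feasible {n : ℕ} (hn : n ≠ 0) {O : Finset (Fin (3 * n))}
    {load : Fin (3 * n) → ℝ} (h0 : ∀ i, 0 ≤ load i)
    (hU : ∀ i, load i ≤ ((n : ℝ) ^ 4 + 1 - 1 / 2 ^ n ^ 2) / n) (hO : ∀ i, i ∉ O → load i = 0)
    (hsum : ∑ i, load i = (n : ℝ) ^ 4 + 1) :
    loadPoint (n ^ 4 + 1) O load ∈ (gapInstance n).feasible := by
  have hM : (0 : ℝ) < (n : ℝ) ^ 4 + 1 := by positivity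
  refine ⟨fun i => ?_, fun i j => ⟨?_, ?_⟩, fun j => ?_, fun i => ?_⟩
  · by_cases h : i ∈ O <;> simp [loadPoint, integralPoint, h]
  · have := h0 i
    simp only [loadPoint, integralPoint, Sum.elim_inr]
    positivity
  · by_cases h : i ∈ O
    · have h1 : load i ≤ (n : ℝ) ^ 4 + 1 := by
        rw [← hsum]
        exact Finset.single_le_sum (fun i _ => h0 i) (Finset.mem_univ i)
      simpa [loadPoint, integralPoint, h] using div_le_one_of_le₀ h1 hM.le
    · simp [loadPoint, integralPoint, h, hO i h]
  · simp only [loadPoint, integralPoint, Sum.elim_inr]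
    rw [← Finset.sum_div, hsum]
    push_cast
    exact div_self hM.ne'
  · have h1 : ∑ j : Fin (n ^ 4 + 1), (gapInstance n).demand j *
        loadPoint (n ^ 4 + 1) O load (Sum.inr (i, j)) = load i := by
      simp only [gapInstance, loadPoint, integralPoint, Sum.elim_inr, one_mul, Finset.sum_const,
        Finset.card_univ, Fintype.card_fin, nsmul_eq_mul]
      field_simp
    rw [h1]
    by_cases h : i ∈ O
    · simpa [loadPoint, integralPoint, h, gapInstance] using hU i
    · simp [loadPoint, integralPoint, h, hO i h]

lemma loadPoint_add {N m : ℕ} (O : Finset (Fin N)) (l a : Fin N → ℝ) :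
    loadPoint m O l + loadPoint m ∅ a = loadPoint m O (l + a) := by
  ext (i | k) <;> simp [loadPoint, integralPoint, add_div]

lemma smul_loadPoint_empty {N m : ℕ} (s : ℝ) (a : Fin N → ℝ) :
    s • loadPoint m ∅ a = loadPoint m ∅ (s • a) := by
  ext (i | k) <;> simp [loadPoint, integralPoint, mul_div_assoc]

/-! ### The gap-inducing distribution -/

section GapPoint

variable {n : ℕ}

/-- One unit of load, shared equally by the facilities of `A`, of which there will be `n`. -/
noncomputable def share (n : ℕ) (A : Finset (Fin (3 * n))) (i : Fin (3 * n)) : ℝ :=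
  if i ∈ A then 1 / n else 0

/-- Each facility `b` outside of `D` is opened with probability `1 / n ^ 2`, at most one at a time;
`none` is the event that none of them is open. -/
noncomputable def gapWeight (n : ℕ) (D : Finset (Fin (3 * n))) : Option (Fin (3 * n)) → ℝ
  | none => 1 - 1 / n
  | some b => if b ∈ D then 0 else 1 / (n : ℝ) ^ 2

/-- The open facilities in an event: all of `D`, and the additional one, if any. -/
def gapOpen (D : Finset (Fin (3 * n))) : Option (Fin (3 * n)) → Finset (Fin (3 * n))
  | none => D
  | some b => insert b D

/-- The loads in an event. An additional facility takes one unit, and `A` serves the rest; in the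
event `none`, this exceeds the capacity of `A`. -/
noncomputable def gapLoad (n : ℕ) (A : Finset (Fin (3 * n))) :
    Option (Fin (3 * n)) → Fin (3 * n) → ℝ
  | none => ((n : ℝ) ^ 4 + 1) • share n A
  | some b => (n : ℝ) ^ 4 • share n A + Pi.single b 1

/-- The point of the relaxation in an event. -/
noncomputable def gapPoint (n : ℕ) (D A : Finset (Fin (3 * n))) (e : Option (Fin (3 * n))) :
    CFLVar (3 * n) (n ^ 4 + 1) → ℝ :=
  loadPoint (n ^ 4 + 1) (gapOpen D e) (gapLoad n A e)

/-- The mean of the points `gapPoint n D A e`, conditioned on no facility of `W` being open. -/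
noncomputable def condPoint (n : ℕ) (D A W : Finset (Fin (3 * n))) :
    CFLVar (3 * n) (n ^ 4 + 1) → ℝ :=
  (Finset.insertNone (Dᶜ \ W)).centerMass (gapWeight n D) (gapPoint n D A)

lemma sum_share {A : Finset (Fin (3 * n))} (hn : n ≠ 0) (hA : A.card = n) :
    ∑ i, share n A i = 1 := by
  simp [share, hA, hn]

lemma gapWeight_nonneg (D : Finset (Fin (3 * n))) (e : Option (Fin (3 * n))) :
    0 ≤ gapWeight n D e := by
  rcases e with _ | b
  · rcases Nat.eq_zero_or_pos n with rfl | hn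
    · simp [gapWeight]
    · simpa [gapWeight] using Nat.cast_inv_le_one n
  · simp only [gapWeight]
    split_ifs <;> positivity

lemma sum_insertNone_gapWeight (D W : Finset (Fin (3 * n))) :
    ∑ e ∈ Finset.insertNone (Dᶜ \ W), gapWeight n D e =
      1 - 1 / n + (Dᶜ \ W).card * (1 / (n : ℝ) ^ 2) := by
  rw [Finset.sum_insertNone, ← nsmul_eq_mul, ← Finset.sum_const]
  congr 1
  refine Finset.sum_congr rfl fun b hb => ?_
  simp only [Finset.mem_sdiff, Finset.mem_compl] at hb
  simp [gapWeight, hb.1]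

lemma sum_gapWeight (hn : n ≠ 0) {D : Finset (Fin (3 * n))} (hD : Dᶜ.card = n) :
    ∑ e, gapWeight n D e = 1 := by
  have h := sum_insertNone_gapWeight D ∅
  rw [Finset.sdiff_empty, hD] at h
  rw [← Finset.sum_subset (Finset.subset_univ (Finset.insertNone Dᶜ)), h]
  · field_simp
    ring
  · rintro (_ | b) _ hb
    · simp at hb
    · have hb : b ∈ D := by simpa using hb
      simp [gapWeight, hb]

lemma two_mul_add_one_div_two_pow_le (hn : 2 ≤ n) : (2 * n + 1) * (1 / 2 ^ n ^ 2 : ℝ) ≤ 1 := by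
  rw [mul_one_div, div_le_one (by positivity)]
  have h1 : n + 1 ≤ 2 ^ n := Nat.lt_two_pow_self
  have h2 : 2 ^ (n * 2) ≤ 2 ^ n ^ 2 := Nat.pow_le_pow_right two_pos (by nlinarith)
  have h3 : 2 * n + 1 ≤ 2 ^ n ^ 2 := by
    refine le_trans ?_ h2
    rw [pow_mul]
    nlinarith
  exact_mod_cast h3

lemma loadPoint_mem_feasible_of_none (hn : 2 ≤ n) {D A : Finset (Fin (3 * n))} (hAD : A ⊆ D)
    (hA : A.card = n) {i : Fin (3 * n)} (hi : i ∈ D \ A) {s : ℝ}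
    (hs : 1 / 2 ^ n ^ 2 ≤ s) (hs1 : s ≤ 1) :
    loadPoint (n ^ 4 + 1) D (((n : ℝ) ^ 4 + 1 - s) • share n A + Pi.single i s) ∈
      (gapInstance n).feasible := by
  obtain ⟨hiD, hiA⟩ := Finset.mem_sdiff.1 hi
  have hn' : (2 : ℝ) ≤ n := by exact_mod_cast hn
  have hδ : (0 : ℝ) < 1 / 2 ^ n ^ 2 := by positivity
  have h4 : (n : ℝ) ≤ (n : ℝ) ^ 4 := le_self_pow₀ (by linarith) (by norm_num)
  have hU : (1 : ℝ) ≤ ((n : ℝ) ^ 4 + 1 - 1 / 2 ^ n ^ 2) / n := by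
    rw [le_div_iff₀ (by linarith)]
    linarith
  have hload : ∀ k, (((n : ℝ) ^ 4 + 1 - s) • share n A + Pi.single i s : Fin (3 * n) → ℝ) k =
      if k ∈ A then ((n : ℝ) ^ 4 + 1 - s) / n else if k = i then s else 0 := by
    intro k
    by_cases hk : k ∈ A
    · have : k ≠ i := by rintro rfl; exact hiA hk
      simp [share, hk, this, div_eq_mul_inv]
    · by_cases hki : k = i
      · subst hki
        simp [share, hk]
      · simp [share, hk, hki]
  refine loadPoint_mem_feasible (by omega) (fun k => ?_) (fun k => ?_) (fun k hk => ?_) ?_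
  · rw [hload]
    split_ifs
    · exact div_nonneg (by linarith) (by linarith)
    · linarith
    · exact le_rfl
  · rw [hload]
    split_ifs
    · gcongr
    · linarith
    · linarith
  · rw [hload, if_neg fun h => hk (hAD h), if_neg]
    rintro rfl
    exact hk hiD
  · simp only [Pi.add_apply, Pi.smul_apply, smul_eq_mul, Finset.sum_add_distrib,
      ← Finset.mul_sum, sum_share (by omega) hA, Finset.sum_pi_single', Finset.mem_univ, if_true]
    ring

lemma loadPoint_mem_feasible_of_some (hn : 2 ≤ n) {D A : Finset (Fin (3 * n))} (hAD : A ⊆ D)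
    (hA : A.card = n) {b i : Fin (3 * n)} (hb : b ∉ D) (hi : i ∈ A) {s : ℝ}
    (hs : 0 ≤ s) (hs1 : s + 1 / 2 ^ n ^ 2 ≤ 1) :
    loadPoint (n ^ 4 + 1) (insert b D)
      (((n : ℝ) ^ 4 + s) • share n A + Pi.single b 1 - Pi.single i s) ∈
        (gapInstance n).feasible := by
  have hn' : (2 : ℝ) ≤ n := by exact_mod_cast hn
  have hδ : (0 : ℝ) < 1 / 2 ^ n ^ 2 := by positivity
  have h4 : (n : ℝ) ≤ (n : ℝ) ^ 4 := le_self_pow₀ (by linarith) (by norm_num)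
  have hU : (1 : ℝ) ≤ ((n : ℝ) ^ 4 + 1 - 1 / 2 ^ n ^ 2) / n := by
    rw [le_div_iff₀ (by linarith)]
    linarith
  have hload : ∀ k,
      (((n : ℝ) ^ 4 + s) • share n A + Pi.single b 1 - Pi.single i s : Fin (3 * n) → ℝ) k =
      if k ∈ A then ((n : ℝ) ^ 4 + s) / n - (if k = i then s else 0)
      else if k = b then 1 else 0 := by
    intro k
    by_cases hk : k ∈ A
    · have : k ≠ b := by rintro rfl; exact hb (hAD hk)
      simp [share, hk, this, div_eq_mul_inv, Pi.single_apply]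
    · have : k ≠ i := by rintro rfl; exact hk hi
      simp [share, hk, this, Pi.single_apply]
  refine loadPoint_mem_feasible (by omega) (fun k => ?_) (fun k => ?_) (fun k hk => ?_) ?_
  · have h1 : s ≤ ((n : ℝ) ^ 4 + s) / n := by
      rw [le_div_iff₀ (by linarith)]
      nlinarith
    rw [hload]
    split_ifs <;> linarith
  · have h1 : ((n : ℝ) ^ 4 + s) / n ≤ ((n : ℝ) ^ 4 + 1 - 1 / 2 ^ n ^ 2) / n := by
      gcongr
      linarith
    rw [hload]
    split_ifs <;> linarith
  · simp only [Finset.mem_insert, not_or] at hk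
    rw [hload, if_neg fun h => hk.2 (hAD h), if_neg hk.1]
  · simp only [Pi.add_apply, Pi.sub_apply, Pi.smul_apply, smul_eq_mul, Finset.sum_add_distrib,
      Finset.sum_sub_distrib, ← Finset.mul_sum, sum_share (by omega) hA, Finset.sum_pi_single',
      Finset.mem_univ, if_true]
    ring

lemma gapPoint_some_mem_feasible (hn : 2 ≤ n) {D A : Finset (Fin (3 * n))} (hAD : A ⊆ D)
    (hA : A.card = n) {b : Fin (3 * n)} (hb : b ∉ D) :
    gapPoint n D A (some b) ∈ (gapInstance n).feasible := by
  obtain ⟨i, hi⟩ : A.Nonempty := Finset.card_pos.1 (by omega)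
  have h := two_mul_add_one_div_two_pow_le hn
  have hδ : (0 : ℝ) < 1 / 2 ^ n ^ 2 := by positivity
  have hn' : (2 : ℝ) ≤ n := by exact_mod_cast hn
  simpa [gapPoint, gapOpen, gapLoad] using
    loadPoint_mem_feasible_of_some hn hAD hA hb hi le_rfl (by nlinarith)

/-- The conditional means are close to the polytope: it is enough to move `2 ^ (-n ^ 2)` units of
load from one facility `i'` of `A` to an open facility `i` outside of `A`. In the event `none`,
`i` relieves `A` of its excess; in the other events, `A` has room for the load taken from `i'`. -/
lemma condPoint_add_mem_polytope (hn : 2 ≤ n) {D A W : Finset (Fin (3 * n))} (hAD : A ⊆ D)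
    (hA : A.card = n) (hD : Dᶜ.card = n) (hWD : W ⊆ Dᶜ) (hW : 2 * W.card ≤ n)
    {i i' : Fin (3 * n)} (hi : i ∈ D \ A) (hi' : i' ∈ A) :
    condPoint n D A W + loadPoint (n ^ 4 + 1) ∅
      ((1 / 2 ^ n ^ 2 : ℝ) • (Pi.single i 1 - Pi.single i' 1)) ∈ (gapInstance n).polytope := by
  have hn' : (2 : ℝ) ≤ n := by exact_mod_cast hn
  have hbound := two_mul_add_one_div_two_pow_le hn
  have hδ : (0 : ℝ) < 1 / 2 ^ n ^ 2 := by positivity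
  have hK : (Dᶜ \ W).card + W.card = n := by
    rw [Finset.card_sdiff_add_card_eq_card hWD, hD]
  have hω := sum_insertNone_gapWeight D W
  set ω := ∑ e ∈ Finset.insertNone (Dᶜ \ W), gapWeight n D e with hωdef
  have hK1 : (n : ℝ) ≤ 2 * (Dᶜ \ W).card := by exact_mod_cast (by omega : n ≤ 2 * (Dᶜ \ W).card)
  have hK2 : ((Dᶜ \ W).card : ℝ) ≤ n := by exact_mod_cast (by omega : (Dᶜ \ W).card ≤ n)
  set K : ℝ := ((Dᶜ \ W).card : ℝ) with hKdef
  set δ : ℝ := 1 / 2 ^ n ^ 2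
  have hp : (1 : ℝ) / 2 ≤ 1 - 1 / n := by
    have : (1 : ℝ) / n ≤ 1 / 2 := one_div_le_one_div_of_le two_pos hn'
    linarith
  have hω1 : ω ≤ 1 := by
    have : K * (1 / (n : ℝ) ^ 2) ≤ n * (1 / (n : ℝ) ^ 2) := by gcongr
    have h2 : (n : ℝ) * (1 / (n : ℝ) ^ 2) = 1 / n := by field_simp
    linarith
  have hω2 : 1 - 1 / (n : ℝ) ≤ ω := by
    have : 0 ≤ K * (1 / (n : ℝ) ^ 2) := by positivity
    linarith
  -- The corrections in the two kinds of events, scaled to have the right means.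
  set s₀ : ℝ := ω * δ / (1 - 1 / n) with hs₀
  set s₁ : ℝ := ω * δ * n ^ 2 / K with hs₁
  let u : Option (Fin (3 * n)) → CFLVar (3 * n) (n ^ 4 + 1) → ℝ := fun e =>
    gapPoint n D A e + loadPoint (n ^ 4 + 1) ∅
      (e.elim (s₀ • (Pi.single i 1 - share n A)) fun _ => s₁ • (share n A - Pi.single i' 1))
  have hs₀δ : δ ≤ s₀ := by
    rw [hs₀, le_div_iff₀ (by linarith)]
    nlinarith
  have hs₀1 : s₀ ≤ 1 := by
    rw [hs₀, div_le_one (by linarith)]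
    nlinarith
  have hs₁0 : 0 ≤ s₁ := by
    have : 0 ≤ ω := by linarith
    positivity
  have hs₁1 : s₁ ≤ 2 * n * δ := by
    rw [hs₁, div_le_iff₀ (by linarith)]
    have h1 : ω * δ * n ^ 2 ≤ 1 * δ * n ^ 2 := by gcongr
    have h2 : n * δ * n ≤ n * δ * (2 * K) := by gcongr
    linarith
  have hu : ∀ e ∈ Finset.insertNone (Dᶜ \ W), u e ∈ (gapInstance n).feasible := by
    rintro (_ | b) he
    · convert loadPoint_mem_feasible_of_none hn hAD hA hi hs₀δ hs₀1 using 1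
      simp only [u, gapPoint, gapOpen, gapLoad, Option.elim, loadPoint_add]
      congr 1
      ext k
      simp only [Pi.add_apply, Pi.sub_apply, Pi.smul_apply, Pi.single_apply, smul_eq_mul]
      split_ifs <;> ring
    · simp only [Finset.some_mem_insertNone, Finset.mem_sdiff, Finset.mem_compl] at he
      convert loadPoint_mem_feasible_of_some hn hAD hA he.1 hi' hs₁0 (by linarith) using 1
      simp only [u, gapPoint, gapOpen, gapLoad, Option.elim, loadPoint_add]
      congr 1
      ext k
      simp only [Pi.add_apply, Pi.sub_apply, Pi.smul_apply, Pi.single_apply, smul_eq_mul]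
      split_ifs <;> ring
  have hmean : (Finset.insertNone (Dᶜ \ W)).centerMass (gapWeight n D) u =
      condPoint n D A W + loadPoint (n ^ 4 + 1) ∅ (δ • (Pi.single i 1 - Pi.single i' 1)) := by
    have hsome : ∀ b ∈ Dᶜ \ W, gapWeight n D (some b) = 1 / (n : ℝ) ^ 2 := by
      intro b hb
      simp only [Finset.mem_sdiff, Finset.mem_compl] at hb
      simp [gapWeight, hb.1]
    have hcorr : ∑ e ∈ Finset.insertNone (Dᶜ \ W), gapWeight n D e •
        loadPoint (n ^ 4 + 1) ∅ (e.elim (s₀ • (Pi.single i 1 - share n A))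
          fun _ => s₁ • (share n A - Pi.single i' 1)) =
        ω • loadPoint (n ^ 4 + 1) ∅ (δ • (Pi.single i 1 - Pi.single i' 1)) := by
      rw [Finset.sum_insertNone, Finset.sum_congr rfl fun b hb => by rw [hsome b hb]]
      simp only [Option.elim, Finset.sum_const, ← Nat.cast_smul_eq_nsmul ℝ,
        smul_loadPoint_empty, loadPoint_add, smul_smul]
      rw [← hKdef]
      have h1 : (1 - 1 / (n : ℝ)) * s₀ = ω * δ := by
        rw [hs₀]
        exact mul_div_cancel₀ _ (by linarith)
      have h2 : K * (1 / (n : ℝ) ^ 2 * s₁) = ω * δ := by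
        have : K ≠ 0 := by linarith
        rw [hs₁]
        field_simp
      simp only [gapWeight]
      rw [h1, h2, ← smul_add, sub_add_sub_cancel]
    have hω0 : ω ≠ 0 := by linarith
    simp only [condPoint, Finset.centerMass, u, smul_add, Finset.sum_add_distrib]
    rw [hcorr, ← hωdef, smul_smul, inv_mul_cancel₀ hω0, one_smul]
  rw [← hmean]
  refine (convex_convexHull ℝ _).centerMass_mem (fun e _ => gapWeight_nonneg D e) ?_
    fun e he => subset_convexHull ℝ _ (hu e he)
  rw [← hωdef]
  linarith

/-- For distinct `A` and `A'` of the same size, move load from some `i' ∈ A \ A'` to some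
`i ∈ A' \ A` in a conditional mean of `A`, and back in one of `A'`: the sum does not change, and
both points get into the polytope. Hence no inequality is violated for two choices of `A`. -/
lemma exists_condPoint_subset_polyhedron (hn : 2 ≤ n) {D : Finset (Fin (3 * n))}
    (hD : Dᶜ.card = n) (hD2 : D.card = 2 * n) {r : ℕ} {P : LinSystem (CFLVar (3 * n) (n ^ 4 + 1)) r}
    (hP : (gapInstance n).polytope ⊆ P.polyhedron)
    (hsize : polyhedronSize P.polyhedron < n.centralBinom) :
    ∃ A ⊆ D, A.card = n ∧
      ∀ W ⊆ Dᶜ, 2 * W.card ≤ n → condPoint n D A W ∈ P.polyhedron := by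
  suffices h : ∃ A ∈ D.powersetCard n,
      {v | ∃ W ⊆ Dᶜ, 2 * W.card ≤ n ∧ v = condPoint n D A W} ⊆ P.polyhedron by
    obtain ⟨A, hA, hX⟩ := h
    obtain ⟨hAD, hAn⟩ := Finset.mem_powersetCard.1 hA
    exact ⟨A, hAD, hAn, fun W hWD hW => hX ⟨W, hWD, hW, rfl⟩⟩
  refine exists_subset_polyhedron P _ _
    (by rwa [Finset.card_powersetCard, hD2, ← Nat.centralBinom_eq_two_mul_choose]) ?_
  rintro A hA A' hA' hne _ ⟨W, hWD, hW, rfl⟩ _ ⟨W', hWD', hW', rfl⟩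
  obtain ⟨hAD, hAn⟩ := Finset.mem_powersetCard.1 hA
  obtain ⟨hAD', hAn'⟩ := Finset.mem_powersetCard.1 hA'
  obtain ⟨i, hi, hiA⟩ : ∃ i ∈ A', i ∉ A := Finset.not_subset.1 fun h =>
    hne (Finset.eq_of_subset_of_card_le h (by omega)).symm
  obtain ⟨i', hi', hiA'⟩ : ∃ i ∈ A, i ∉ A' := Finset.not_subset.1 fun h =>
    hne (Finset.eq_of_subset_of_card_le h (by omega))
  refine ⟨_, hP (condPoint_add_mem_polytope hn hAD hAn hD hWD hW
      (Finset.mem_sdiff.2 ⟨hAD' hi, hiA⟩) hi'),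
    _, hP (condPoint_add_mem_polytope hn hAD' hAn' hD hWD' hW'
      (Finset.mem_sdiff.2 ⟨hAD hi', hiA'⟩) hi), ?_⟩
  rw [add_add_add_comm, loadPoint_add, ← smul_add, sub_add_sub_cancel, sub_self, smul_zero]
  ext (k | k) <;> simp [loadPoint, integralPoint]

lemma sum_smul_gapPoint_mem_sheraliAdams (hn : 2 ≤ n) {D A : Finset (Fin (3 * n))} (hAD : A ⊆ D)
    (hA : A.card = n) (hD : Dᶜ.card = n) {r : ℕ} {P : LinSystem (CFLVar (3 * n) (n ^ 4 + 1)) r}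
    (hP : (gapInstance n).polytope ⊆ P.polyhedron)
    (hcond : ∀ W ⊆ Dᶜ, 2 * W.card ≤ n → condPoint n D A W ∈ P.polyhedron) {t : ℕ}
    (ht : 2 * t ≤ n) :
    ∑ e, gapWeight n D e • gapPoint n D A e ∈ sheraliAdams P t := by
  refine sum_smul_mem_sheraliAdams (sum_gapWeight (by omega) hD) fun a U W hU hWU => ?_
  change (∑ e, if U \ W ⊆ gapOpen D e ∧ Disjoint W (gapOpen D e) then
    gapWeight n D e * (∑ k, P.A a k * gapPoint n D A e k - P.b a) else 0) ≤ 0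
  by_cases h : U \ W ⊆ D ∧ Disjoint W D
  · -- The event contains `none`, and is that no facility of `W` is open.
    have hWD : W ⊆ Dᶜ := fun k hk => Finset.mem_compl.2 (Finset.disjoint_left.1 h.2 hk)
    have hevent : (∑ e, if U \ W ⊆ gapOpen D e ∧ Disjoint W (gapOpen D e) then
        gapWeight n D e * (∑ k, P.A a k * gapPoint n D A e k - P.b a) else 0) =
        ∑ e ∈ Finset.insertNone (Dᶜ \ W),
          gapWeight n D e * (∑ k, P.A a k * gapPoint n D A e k - P.b a) := by
      rw [Fintype.sum_option, Finset.sum_insertNone]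
      congr 1
      · simp [gapOpen, h]
      · rw [← Finset.sum_subset (Finset.subset_univ (Dᶜ \ W))]
        · refine Finset.sum_congr rfl fun b hb => if_pos ⟨?_, ?_⟩
          · exact h.1.trans (Finset.subset_insert b D)
          · exact Finset.disjoint_insert_right.2 ⟨(Finset.mem_sdiff.1 hb).2, h.2⟩
        · intro b _ hb
          simp only [Finset.mem_sdiff, Finset.mem_compl, not_and, not_not] at hb
          by_cases hbD : b ∈ D
          · simp [gapWeight, hbD]
          · exact if_neg fun hc => (Finset.disjoint_insert_right.1 hc.2).1 (hb hbD)
    have hWcard : W.card ≤ U.card := Finset.card_le_card hWU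
    have hmem := hcond W hWD (by omega) a
    have hω : 0 < ∑ e ∈ Finset.insertNone (Dᶜ \ W), gapWeight n D e := by
      rw [sum_insertNone_gapWeight]
      have h1 : (1 : ℝ) / n < 1 :=
        (div_lt_one (by positivity)).2 (by exact_mod_cast (by omega : 1 < n))
      have h2 : 0 ≤ ((Dᶜ \ W).card : ℝ) * (1 / (n : ℝ) ^ 2) := by positivity
      linarith
    have hmean : ∑ k, P.A a k * condPoint n D A W k =
        (∑ e ∈ Finset.insertNone (Dᶜ \ W), gapWeight n D e)⁻¹ *
          ∑ e ∈ Finset.insertNone (Dᶜ \ W),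
            gapWeight n D e * ∑ k, P.A a k * gapPoint n D A e k := by
      simp only [condPoint, Finset.centerMass, Pi.smul_apply, Finset.sum_apply, smul_eq_mul,
        Finset.mul_sum]
      rw [Finset.sum_comm]
      exact Finset.sum_congr rfl fun _ _ => Finset.sum_congr rfl fun _ _ => by ring
    rw [hmean, inv_mul_le_iff₀ hω] at hmem
    rw [hevent]
    simp only [mul_sub, Finset.sum_sub_distrib, ← Finset.sum_mul]
    linarith
  · -- All the points in the event are feasible.
    refine Finset.sum_nonpos fun e _ => ?_
    split_ifs with he
    · rcases e with _ | b
      · exact absurd he h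
      · by_cases hb : b ∈ D
        · simp [gapWeight, hb]
        · have hmem := hP (subset_convexHull ℝ _ (gapPoint_some_mem_feasible hn hAD hA hb)) a
          exact mul_nonpos_of_nonneg_of_nonpos (gapWeight_nonneg D _) (by linarith)
    · exact le_rfl

/-! ### The objective function -/

/-- Opening a facility outside of `D` costs `1`, and the facilities of `D \ A` are at distance
`2 ^ n ^ 2` from all the clients; everything else is free. -/
noncomputable def gapCost (n : ℕ) (D A : Finset (Fin (3 * n))) : CFLCost (3 * n) (n ^ 4 + 1) where
  opening i := if i ∈ D then 0 else 1
  conn i _ := if i ∈ D \ A then 2 ^ n ^ 2 else 0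
  opening_nonneg i := by split_ifs <;> simp
  conn_nonneg i j := by split_ifs <;> positivity
  conn_triangle i i' j j' := by
    have : (0 : ℝ) ≤ if i' ∈ D \ A then 2 ^ n ^ 2 else 0 := by split_ifs <;> positivity
    linarith

/-- The free facilities lack a capacity of `2 ^ (-n ^ 2)`. -/
lemma one_le_cost_of_mem_feasible (hn : n ≠ 0) {D A : Finset (Fin (3 * n))} (hAD : A ⊆ D)
    (hA : A.card = n) {v : CFLVar (3 * n) (n ^ 4 + 1) → ℝ} (hv : v ∈ (gapInstance n).feasible) :
    1 ≤ (gapInstance n).cost (gapCost n D A) v := by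
  obtain ⟨hy, hx, hsum, hcap⟩ := hv
  have hy0 : ∀ i, 0 ≤ v (Sum.inl i) := fun i => by rcases hy i with h | h <;> simp [h]
  have hopen : ∀ i, 0 ≤ (gapCost n D A).opening i * v (Sum.inl i) := fun i =>
    mul_nonneg ((gapCost n D A).opening_nonneg i) (hy0 i)
  have hconn : ∀ i j, 0 ≤ (gapCost n D A).conn i j *
      ((gapInstance n).demand j * v (Sum.inr (i, j))) := fun i j =>
    mul_nonneg ((gapCost n D A).conn_nonneg i j) (by simpa [gapInstance] using (hx i j).1)
  have hconn' := Finset.sum_nonneg fun i (_ : i ∈ Finset.univ) =>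
    Finset.sum_nonneg fun j (_ : j ∈ Finset.univ) => hconn i j
  unfold CFLInstance.cost
  by_cases h : ∃ b ∉ D, v (Sum.inl b) = 1
  · obtain ⟨b, hb, hvb⟩ := h
    have h1 := Finset.single_le_sum (fun i _ => hopen i) (Finset.mem_univ b)
    simp only [gapCost, hb, hvb, if_false, mul_one] at h1 hconn' ⊢
    linarith
  · push Not at h
    have hopen' := Finset.sum_nonneg fun i (_ : i ∈ Finset.univ) => hopen i
    let X : Fin (3 * n) → ℝ := fun i => ∑ j, v (Sum.inr (i, j))
    have hX0 : ∀ i, i ∉ D → X i = 0 := fun i hi => Finset.sum_eq_zero fun j _ => by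
      have h1 := hx i j
      rw [(hy i).resolve_right (h i hi)] at h1
      linarith
    have htotal : ∑ i, X i = (n : ℝ) ^ 4 + 1 := by
      simp only [X]
      rw [Finset.sum_comm]
      simp [hsum]
    have hXA : ∑ i ∈ A, X i ≤ (n : ℝ) ^ 4 + 1 - 1 / 2 ^ n ^ 2 := by
      have hU : ∀ i ∈ A, X i ≤ ((n : ℝ) ^ 4 + 1 - 1 / 2 ^ n ^ 2) / n := fun i _ => by
        have h1 := hcap i
        have h0 : (0 : ℝ) ≤ ((n : ℝ) ^ 4 + 1 - 1 / 2 ^ n ^ 2) / n := by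
          have h2 : (1 : ℝ) / 2 ^ n ^ 2 ≤ 1 :=
            div_le_one_of_le₀ (one_le_pow₀ one_le_two) (by positivity)
          have h3 : (0 : ℝ) ≤ (n : ℝ) ^ 4 := by positivity
          exact div_nonneg (by linarith) (by positivity)
        simp only [gapInstance, one_mul] at h1
        refine h1.trans ?_
        rcases hy i with h2 | h2 <;> simp only [h2, mul_zero, mul_one, le_refl, h0]
      refine (Finset.sum_le_card_nsmul A X _ hU).trans_eq ?_
      rw [hA, nsmul_eq_mul]
      field_simp
    have hsplit : ∑ i ∈ D \ A, X i + ∑ i ∈ A, X i = ∑ i, X i := by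
      rw [Finset.sum_sdiff hAD]
      exact Finset.sum_subset (Finset.subset_univ D) fun i _ hi => hX0 i hi
    have hcost : ∑ i, ∑ j, (gapCost n D A).conn i j *
        ((gapInstance n).demand j * v (Sum.inr (i, j))) =
        2 ^ n ^ 2 * ∑ i ∈ D \ A, X i := by
      rw [Finset.mul_sum, ← Finset.sum_subset (Finset.subset_univ (D \ A))]
      · refine Finset.sum_congr rfl fun i hi => ?_
        simp only [gapCost, hi, if_true, gapInstance, one_mul, X, Finset.mul_sum]
      · intro i _ hi
        simp only [gapCost, hi, if_false, zero_mul, Finset.sum_const_zero]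
    have hfar : (1 : ℝ) / 2 ^ n ^ 2 ≤ ∑ i ∈ D \ A, X i := by linarith
    have hone : (1 : ℝ) ≤ 2 ^ n ^ 2 * ∑ i ∈ D \ A, X i :=
      calc (1 : ℝ) = 2 ^ n ^ 2 * (1 / 2 ^ n ^ 2) := by field_simp
        _ ≤ _ := by gcongr
    rw [hcost]
    linarith

lemma cost_sum_smul_gapPoint (hn : n ≠ 0) {D A : Finset (Fin (3 * n))} (hD : Dᶜ.card = n) :
    (gapInstance n).cost (gapCost n D A) (∑ e, gapWeight n D e • gapPoint n D A e) = 1 / n := by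
  have hint : ∀ i, i ∉ D → (∑ e, gapWeight n D e • gapPoint n D A e) (Sum.inl i) =
      1 / (n : ℝ) ^ 2 := by
    intro i hi
    rw [Finset.sum_apply, Fintype.sum_option, Finset.sum_eq_single i]
    · simp [gapPoint, gapOpen, gapWeight, loadPoint, integralPoint, hi]
    · intro b _ hb
      simp [gapPoint, gapOpen, loadPoint, integralPoint, hi, hb.symm]
    · simp
  have hfrac : ∀ i ∈ D \ A, ∀ j, (∑ e, gapWeight n D e • gapPoint n D A e) (Sum.inr (i, j)) = 0 := by
    intro i hi j
    obtain ⟨hiD, hiA⟩ := Finset.mem_sdiff.1 hi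
    rw [Finset.sum_apply]
    refine Finset.sum_eq_zero fun e _ => ?_
    rcases e with _ | b
    · simp [gapPoint, gapLoad, loadPoint, integralPoint, share, hiA]
    · by_cases hb : i = b
      · subst hb
        simp [gapWeight, hiD]
      · simp [gapPoint, gapLoad, loadPoint, integralPoint, share, hiA, hb]
  have hconn : ∀ i j, (gapCost n D A).conn i j * ((gapInstance n).demand j *
      (∑ e, gapWeight n D e • gapPoint n D A e) (Sum.inr (i, j))) = 0 := by
    intro i j
    by_cases hi : i ∈ D \ A
    · rw [hfrac i hi, mul_zero, mul_zero]
    · simp only [gapCost, hi, if_false, zero_mul]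
  have hopen : ∑ i, (gapCost n D A).opening i *
      (∑ e, gapWeight n D e • gapPoint n D A e) (Sum.inl i) = ∑ i ∈ Dᶜ, 1 / (n : ℝ) ^ 2 := by
    rw [← Finset.sum_subset (Finset.subset_univ Dᶜ)]
    · refine Finset.sum_congr rfl fun i hi => ?_
      rw [Finset.mem_compl] at hi
      rw [hint i hi]
      simp [gapCost, hi]
    · intro i _ hi
      rw [Finset.mem_compl, not_not] at hi
      simp [gapCost, hi]
  unfold CFLInstance.cost
  simp only [hconn, Finset.sum_const_zero, add_zero]
  rw [hopen, Finset.sum_const, hD, nsmul_eq_mul]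
  field_simp

lemma le_integralityGap_of_mem (hn : n ≠ 0) {D A : Finset (Fin (3 * n))} (hAD : A ⊆ D)
    (hA : A.card = n) (hD : Dᶜ.card = n) {K : Set (CFLVar (3 * n) (n ^ 4 + 1) → ℝ)}
    (hK : ∑ e, gapWeight n D e • gapPoint n D A e ∈ K) :
    (n : ℝ≥0∞) ≤ (gapInstance n).integralityGap K := by
  refine le_trans ?_ (le_iSup _ (gapCost n D A))
  have h1 : 1 ≤ ⨅ v ∈ (gapInstance n).feasible,
      ENNReal.ofReal ((gapInstance n).cost (gapCost n D A) v) :=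
    le_iInf₂ fun v hv => ENNReal.one_le_ofReal.2 (one_le_cost_of_mem_feasible hn hAD hA hv)
  have h2 : ⨅ v ∈ K, ENNReal.ofReal ((gapInstance n).cost (gapCost n D A) v) ≤ (n : ℝ≥0∞)⁻¹ := by
    refine (iInf₂_le _ hK).trans_eq ?_
    rw [cost_sum_smul_gapPoint hn hD, one_div, ENNReal.ofReal_inv_of_pos (by positivity),
      ENNReal.ofReal_natCast]
  calc (n : ℝ≥0∞) = 1 / (n : ℝ≥0∞)⁻¹ := by simp
    _ ≤ _ := ENNReal.div_le_div h1 h2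

end GapPoint

theorem theorem6 :
    ∃ c : ℝ, 0 < c ∧ ∃ γ : ℝ, 0 < γ ∧
      ∀ (r : ℕ → ℕ) (P : ∀ n : ℕ, LinSystem (CFLVar (3 * n) (n ^ 4 + 1)) (r n)),
        (∀ n, (gapInstance n).polytope ⊆ (P n).polyhedron) →
        IsTwoPowLittleO (fun n => polyhedronSize (P n).polyhedron) →
        ∀ᶠ n : ℕ in atTop, ∀ t : ℕ, (t : ℝ) ≤ c * n →
          ENNReal.ofReal (γ * n) ≤ (gapInstance n).integralityGap (sheraliAdams (P n) t) := by
  refine ⟨1 / 2, by norm_num, 1, one_pos, fun r P hP hsize => ?_⟩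
  filter_upwards [hsize.eventually_lt_centralBinom, eventually_ge_atTop 2] with n hlt hn t ht
  have ht : 2 * t ≤ n := by
    have : (2 * t : ℝ) ≤ n := by linarith
    exact_mod_cast this
  obtain ⟨D, -, hD2⟩ := Finset.exists_subset_card_eq
    (s := (Finset.univ : Finset (Fin (3 * n)))) (n := 2 * n) (by simp; omega)
  have hD : Dᶜ.card = n := by
    rw [Finset.card_compl, hD2, Fintype.card_fin]
    omega
  obtain ⟨A, hAD, hA, hcond⟩ := exists_condPoint_subset_polyhedron hn hD hD2 (hP n) hlt
  rw [one_mul, ENNReal.ofReal_natCast]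
  exact le_integralityGap_of_mem (by omega) hAD hA hD
    (sum_smul_gapPoint_mem_sheraliAdams hn hAD hA hD (hP n) hcond ht)
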